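/- All graphs are finite, simple and connected. The distance matrix of a connected graph $G$ with vertices $v_1,\dots,v_n$ is $D(G)=(d_{ij})_{n\times n}$, where $d_{ij}$ is the distance between $v_i$ and $v_j$ in $G$; the distance spectrum of $G$ is the multiset of eigenvalues of $D(G)$. A connected graph $G$ is determined by its distance spectrum if every connected graph with the same distance spectrum as $G$ is isomorphic to $G$. **Theorem.** Let $s,t\ge 2$ and $n=s+t$, and let $K_n^{s+t}$ be the graph on $n$ vertices obtained from the disjoint union of the complete graphs $K_s$ and $K_t$ by adding one edge that joins a vertex of $K_s$ to a vertex of $K_t$. Then $K_n^{s+t}$ is determined by its distance spectrum. -/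

import Mathlib

universe u v

namespace SimpleGraph

/-- The distance matrix `D(G)`: its `(x, y)` entry is the distance between `x` and `y` in `G`.
It is only used for connected graphs. -/
noncomputable def distanceMatrix {V : Type u} (G : SimpleGraph V) : Matrix V V ℝ :=
  Matrix.of fun x y => (G.dist x y : ℝ)

theorem distanceMatrix_isHermitian {V : Type u} (G : SimpleGraph V) :
    G.distanceMatrix.IsHermitian := by
  ext x y
  simp [distanceMatrix, G.dist_comm (u := y) (v := x)]

/-- The distance spectrum of `G`: the eigenvalues of the real symmetric matrix `D(G)`,
listed with multiplicity. -/
noncomputable def distanceSpectrum {V : Type u} [Fintype V] [DecidableEq V]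
    (G : SimpleGraph V) : Multiset ℝ :=
  Finset.univ.val.map G.distanceMatrix_isHermitian.eigenvalues

/-- The connected graph `G` is determined by its distance spectrum: every finite connected
graph with the same distance spectrum is isomorphic to `G`. -/
def IsDeterminedByDistanceSpectrum {V : Type u} [Fintype V] [DecidableEq V]
    (G : SimpleGraph V) : Prop :=
  G.Connected ∧
    ∀ (W : Type v) [Fintype W] [DecidableEq W] (H : SimpleGraph W),
      H.Connected → H.distanceSpectrum = G.distanceSpectrum → Nonempty (H ≃g G)

/-- The disjoint union of the complete graphs `K_s` and `K_t`, together with one further edge,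
which joins the vertex `a` of `K_s` to the vertex `b` of `K_t`. -/
def joinedCompleteGraphs (s t : ℕ) (a : Fin s) (b : Fin t) : SimpleGraph (Fin s ⊕ Fin t) :=
  (completeGraph (Fin s) ⊕g completeGraph (Fin t)) ⊔ edge (Sum.inl a) (Sum.inr b)

end SimpleGraph

/-! Work with `A = D + 1`, whose entries are all at least 1. Its rank counts the eigenvalues of `D`
other than -1, and `det (1 + y A)` is a product over eigenvalues, so both depend on the distance
spectrum alone. For the target graph, `A` is a blow-up of the 4 × 4 matrix of a path, with class
sizes `s-1, 1, 1, t-1`; hence the rank is at most 4.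

The core is `exists_block_of_rank_le_four`: a connected graph with `A` of rank at most 4 is a
blow-up of a path, a 4-cycle or a 3-leaf star, possibly with empty classes. If four vertices give an
invertible block `B`, then `A` is determined by its rows on them, and the diagonal entry 1 forces
each such row `r` to satisfy `r B⁻¹ rᵀ = 1` (`posDist_quadratic`). Distances being small, this
leaves only the rows of `B` or a contradiction.

Comparing coefficients of `det (1 + y A)` then rules out the cycle and the star and fixes the path's
class sizes up to reversal. Block and class sizes determine the graph. -/

namespace Matrix

/-! ### Rank and determinant from eigenvalues -/

open Unitary in
theorem IsHermitian.exists_smul_one_add_smul_eq {n : Type*} [Fintype n] [DecidableEq n]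
    {A : Matrix n n ℝ} (hA : A.IsHermitian) :
    ∃ U V : Matrix n n ℝ, V * U = 1 ∧ ∀ x y : ℝ,
      x • (1 : Matrix n n ℝ) + y • A = U * diagonal (fun i => x + y * hA.eigenvalues i) * V := by
  refine ⟨hA.eigenvectorUnitary, star (hA.eigenvectorUnitary : Matrix n n ℝ), by simp, ?_⟩
  intro x y
  have h : diagonal (fun i => x + y * hA.eigenvalues i)
      = x • (1 : Matrix n n ℝ) + y • diagonal (RCLike.ofReal ∘ hA.eigenvalues) := by
    ext i j
    by_cases hij : i = j <;> simp [hij]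
  conv_lhs => rw [hA.spectral_theorem, conjStarAlgAut_apply]
  rw [h, mul_add, add_mul]
  simp

theorem IsHermitian.det_smul_one_add_smul {n : Type*} [Fintype n] [DecidableEq n]
    {A : Matrix n n ℝ} (hA : A.IsHermitian) (x y : ℝ) :
    (x • (1 : Matrix n n ℝ) + y • A).det = ∏ i, (x + y * hA.eigenvalues i) := by
  obtain ⟨U, V, hVU, h⟩ := hA.exists_smul_one_add_smul_eq
  rw [h, det_mul_right_comm, det_mul, mul_eq_one_comm.1 hVU, det_one, one_mul, det_diagonal]

theorem IsHermitian.rank_smul_one_add_smul {n : Type*} [Fintype n] [DecidableEq n]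
    {A : Matrix n n ℝ} (hA : A.IsHermitian) (x y : ℝ) :
    (x • (1 : Matrix n n ℝ) + y • A).rank
      = ((Finset.univ.val.map hA.eigenvalues).filter fun z => x + y * z ≠ 0).card := by
  obtain ⟨U, V, hVU, h⟩ := hA.exists_smul_one_add_smul_eq
  have hd : IsUnit V.det ∧ IsUnit U.det := by
    have := congrArg det hVU
    rw [det_mul, det_one] at this
    exact ⟨.of_mul_eq_one _ this, .of_mul_eq_one_right _ this⟩
  rw [h, rank_mul_eq_left_of_isUnit_det _ _ hd.1, rank_mul_eq_right_of_isUnit_det _ _ hd.2,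
    rank_diagonal, Multiset.filter_map, Multiset.card_map, Fintype.card_subtype]
  rfl

/-! ### Low rank and blow-ups -/

theorem det_submatrix_eq_zero_of_rank_lt {V ι : Type*} [Fintype V] [Fintype ι] [DecidableEq ι]
    {A : Matrix V V ℝ} (h : A.rank < Fintype.card ι) (f g : ι → V) :
    (A.submatrix f g).det = 0 := by
  by_contra hdet
  have h1 := rank_of_isUnit _ ((isUnit_iff_isUnit_det _).2 (Ne.isUnit hdet))
  have h2 := rank_submatrix_le A f g
  omega

/-- A matrix of rank at most `card ι` is determined by the rows and columns through an invertible
`ι × ι` block. -/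
theorem apply_eq_of_rank_le {V ι : Type*} [Fintype V] [Fintype ι] [DecidableEq ι]
    {A : Matrix V V ℝ} (h : A.rank ≤ Fintype.card ι) (f : ι → V) {C : Matrix ι ι ℝ}
    (hC : C * A.submatrix f f = 1) (v w : V) :
    A v w = ∑ i, ∑ j, A v (f i) * C i j * A (f j) w := by
  have hd : (A.submatrix f f).det ≠ 0 := by
    intro h0
    have := congrArg det hC
    simp [h0] at this
  have hC' : C = (A.submatrix f f)⁻¹ := (inv_eq_left_inv hC).symm
  have : Invertible (A.submatrix f f) := invertibleOfLeftInverse _ _ hC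
  -- Bordering the invertible block by row `v` and column `w` gives a vanishing minor, so its Schur
  -- complement is zero.
  have h0 := det_submatrix_eq_zero_of_rank_lt (ι := ι ⊕ Unit) (A := A)
    (by simpa [Nat.lt_succ_iff] using h) (Sum.elim f fun _ => v) (Sum.elim f fun _ => w)
  have hb : A.submatrix (Sum.elim f fun _ : Unit => v) (Sum.elim f fun _ : Unit => w)
      = fromBlocks (A.submatrix f f) (A.submatrix f fun _ => w) (A.submatrix (fun _ => v) f)
          (A.submatrix (fun _ => v) fun _ => w) := by
    ext i j
    rcases i with i | i <;> rcases j with j | j <;> rfl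
  rw [hb, det_fromBlocks₁₁, mul_eq_zero, or_iff_right hd, det_unique, invOf_eq_nonsing_inv,
    ← hC'] at h0
  simp only [PUnit.default_eq_unit, sub_apply, submatrix_apply, mul_apply, Finset.sum_mul] at h0
  rw [sub_eq_zero.1 h0, Finset.sum_comm]

/-- If every row of `A` agrees on `f` with a row of an invertible block `B`, and `A` has rank at
most the size of `B`, then `A` is a blow-up of `B`. -/
theorem eq_submatrix_of_rank_le {V ι : Type*} [Fintype V] [Fintype ι] [DecidableEq ι]
    {A : Matrix V V ℝ} (hA : A.IsSymm) (h : A.rank ≤ Fintype.card ι) (f : ι → V)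
    {B C : Matrix ι ι ℝ} (hB : A.submatrix f f = B) (hC : C * B = 1)
    (c : V → ι) (hc : ∀ v i, A v (f i) = B (c v) i) :
    A = B.submatrix c c := by
  subst hB
  ext v w
  rw [submatrix_apply, submatrix_apply, apply_eq_of_rank_le h f hC v w,
    apply_eq_of_rank_le h f hC (f (c v)) (f (c w))]
  refine Finset.sum_congr rfl fun i _ => Finset.sum_congr rfl fun j _ => ?_
  rw [hc v i, ← hA.apply (f j) w, hc w j, submatrix_apply, submatrix_apply, hA.apply (f j)]

/-- The blow-up factors through the class indicator matrix; `det (1 + XY) = det (1 + YX)` moves the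
computation to the small index type, where class sizes become weights. -/
theorem det_one_add_smul_submatrix {V ι : Type*} [Fintype V] [DecidableEq V] [Fintype ι]
    [DecidableEq ι] (B : Matrix ι ι ℝ) (c : V → ι) (y : ℝ) :
    (1 + y • B.submatrix c c).det
      = (1 + y • (B * diagonal fun i => (Fintype.card {v // c v = i} : ℝ))).det := by
  have h1 : B.submatrix c c = (1 : Matrix ι ι ℝ).submatrix c id * (B.submatrix id c) := by
    ext i j
    simp [mul_apply, one_apply]
  have h2 : (B.submatrix id c) * (1 : Matrix ι ι ℝ).submatrix c id
      = B * diagonal fun i => (Fintype.card {v // c v = i} : ℝ) := by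
    ext i j
    rw [mul_diagonal]
    simp only [mul_apply, submatrix_apply, id, one_apply, mul_ite, mul_one, mul_zero,
      Fintype.card_subtype, Finset.sum_ite]
    simp only [Finset.sum_const_zero, add_zero]
    rw [Finset.sum_congr rfl (g := fun _ => B i j) (by simp +contextual)]
    simp [mul_comm]
  rw [h1, ← Matrix.smul_mul, det_one_add_mul_comm, Matrix.mul_smul, h2]

theorem rank_submatrix_le_card {V ι : Type*} [Fintype V] [Fintype ι]
    (B : Matrix ι ι ℝ) (c : V → ι) : (B.submatrix c c).rank ≤ Fintype.card ι :=
  (rank_submatrix_le B c c).trans (rank_le_card_width B)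

end Matrix

namespace SimpleGraph

/-! ### Distances in connected graphs -/

section Dist

variable {V : Type*} {G : SimpleGraph V}

/-- The entries of `D(G) + 1`, for a connected graph `G`. -/
noncomputable def posDist (G : SimpleGraph V) (v w : V) : ℕ := max 1 (G.dist v w)

/-- The matrix `D(G) + 1`, for a connected graph `G`. -/
noncomputable def posDistMatrix (G : SimpleGraph V) : Matrix V V ℝ :=
  Matrix.of fun v w => (G.posDist v w : ℝ)

theorem posDist_comm (G : SimpleGraph V) (v w : V) : G.posDist v w = G.posDist w v := by
  simp [posDist, dist_comm]

theorem posDist_self (G : SimpleGraph V) (v : V) : G.posDist v v = 1 := by simp [posDist]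

theorem one_le_posDist (G : SimpleGraph V) (v w : V) : 1 ≤ G.posDist v w := le_max_left _ _

theorem posDistMatrix_isSymm (G : SimpleGraph V) : G.posDistMatrix.IsSymm := by
  ext v w
  simp [posDistMatrix, G.posDist_comm v w]

theorem Connected.posDist_of_ne (hG : G.Connected) {v w : V} (h : v ≠ w) :
    G.posDist v w = G.dist v w :=
  max_eq_right (hG.pos_dist_of_ne h)

theorem Connected.posDistMatrix_eq [DecidableEq V] (hG : G.Connected) :
    G.posDistMatrix = 1 + G.distanceMatrix := by
  ext v w
  by_cases h : v = w
  · simp [h, posDistMatrix, distanceMatrix, posDist]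
  · simp [h, posDistMatrix, distanceMatrix, hG.posDist_of_ne h]

theorem Connected.adj_iff_posDist (hG : G.Connected) {v w : V} :
    G.Adj v w ↔ v ≠ w ∧ G.posDist v w = 1 := by
  rw [← dist_eq_one_iff_adj]
  constructor
  · intro h
    have hne : v ≠ w := by
      rintro rfl
      simp at h
    exact ⟨hne, by rwa [hG.posDist_of_ne hne]⟩
  · rintro ⟨hne, h⟩
    rwa [hG.posDist_of_ne hne] at h

theorem Connected.posDist_le_add_one (hG : G.Connected) {v w : V} (u : V)
    (h : G.posDist v w = 1) : G.posDist u w ≤ G.posDist u v + 1 := by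
  have := hG.dist_triangle (u := u) (v := v) (w := w)
  unfold posDist at *
  omega

theorem Connected.exists_dist_eq (hG : G.Connected) {u v : V} {k : ℕ}
    (h : G.dist u v = k + 1) : ∃ w, G.dist u w = 1 ∧ G.dist w v = k := by
  obtain ⟨p, hp⟩ := hG.exists_walk_length_eq_dist u v
  cases p with
  | nil => simp at h
  | @cons _ w _ hadj q =>
    rw [Walk.length_cons] at hp
    have h1 := dist_eq_one_iff_adj.2 hadj
    have h2 := dist_le q
    have h3 := hG.dist_triangle (u := u) (v := w) (w := v)
    exact ⟨w, h1, by omega⟩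

theorem Connected.exists_dist_eq_of_le (hG : G.Connected) {u v : V} {k : ℕ}
    (h : k ≤ G.dist u v) : ∃ w, G.dist w v = k := by
  induction hn : G.dist u v generalizing u with
  | zero => exact ⟨u, by omega⟩
  | succ n ih =>
    by_cases hk : k = n + 1
    · exact ⟨u, by omega⟩
    · obtain ⟨w, -, hw⟩ := hG.exists_dist_eq hn
      exact ih (by omega) hw

theorem Connected.exists_posDist_eq_one (hG : G.Connected) {u v : V} (h : G.posDist u v = 2) :
    ∃ w, G.posDist u w = 1 ∧ G.posDist w v = 1 := by
  have : G.dist u v = 1 + 1 := by unfold posDist at h; omega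
  obtain ⟨w, h1, h2⟩ := hG.exists_dist_eq this
  exact ⟨w, by simp [posDist, h1], by simp [posDist, h2]⟩

theorem posDist_block_of_six {a b c d : V} {B : Matrix (Fin 4) (Fin 4) ℕ}
    (hs : B.IsSymm) (h1 : ∀ i, B i i = 1)
    (hab : G.posDist a b = B 0 1) (hac : G.posDist a c = B 0 2) (had : G.posDist a d = B 0 3)
    (hbc : G.posDist b c = B 1 2) (hbd : G.posDist b d = B 1 3) (hcd : G.posDist c d = B 2 3)
    (i j : Fin 4) : G.posDist (![a, b, c, d] i) (![a, b, c, d] j) = B i j := by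
  wlog hij : i ≤ j generalizing i j
  · rw [posDist_comm, this j i (le_of_not_ge hij), hs.apply]
  · fin_cases i <;> fin_cases j <;> simp_all [posDist_self]

end Dist

/-- The matrix `D + 1` of the path on four vertices. -/
def pathBlock : Matrix (Fin 4) (Fin 4) ℕ := !![1, 1, 2, 3; 1, 1, 1, 2; 2, 1, 1, 1; 3, 2, 1, 1]

/-- The matrix `D + 1` of the cycle on four vertices. -/
def cycleBlock : Matrix (Fin 4) (Fin 4) ℕ := !![1, 1, 2, 1; 1, 1, 1, 2; 2, 1, 1, 1; 1, 2, 1, 1]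

/-- The matrix `D + 1` of the star with three leaves. -/
def starBlock : Matrix (Fin 4) (Fin 4) ℕ := !![1, 1, 1, 1; 1, 1, 2, 2; 1, 2, 1, 2; 1, 2, 2, 1]

/-! ### Connected graphs with `D + 1` of rank at most four -/

section Rank

variable {V : Type*} {G : SimpleGraph V}

/-- Clearing denominators by `m` makes each inverse an integer identity that `decide` can check. -/
theorem exists_block_inverse {f : Fin 4 → V} {B : Matrix (Fin 4) (Fin 4) ℕ}
    {K : Matrix (Fin 4) (Fin 4) ℤ} {m : ℤ} (hB : ∀ i j, G.posDist (f i) (f j) = B i j)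
    (hm : m ≠ 0) (hK : K * B.map (Nat.cast : ℕ → ℤ) = m • 1) :
    ((m : ℝ)⁻¹ • K.map (Int.cast : ℤ → ℝ)) * G.posDistMatrix.submatrix f f = 1 := by
  have hf : G.posDistMatrix.submatrix f f = (B.map (Nat.cast : ℕ → ℤ)).map (Int.cast : ℤ → ℝ) := by
    ext i j
    simp [posDistMatrix, hB]
  have hm' : (m : ℝ) ≠ 0 := by exact_mod_cast hm
  have hmul : K.map (Int.castRingHom ℝ) * (B.map (Nat.cast : ℕ → ℤ)).map (Int.castRingHom ℝ)
      = (m • (1 : Matrix (Fin 4) (Fin 4) ℤ)).map (Int.castRingHom ℝ) := by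
    rw [← Matrix.map_mul, hK]
  rw [hf, Matrix.smul_mul]
  refine (congrArg _ hmul).trans ?_
  ext i j
  simp only [Matrix.smul_apply, Matrix.map_apply, Matrix.one_apply]
  split_ifs <;> simp [hm']

variable [Fintype V]

theorem rank_posDistMatrix_le {B : Matrix (Fin 4) (Fin 4) ℕ} {c : V → Fin 4}
    (hc : ∀ v w, G.posDist v w = B (c v) (c w)) : G.posDistMatrix.rank ≤ 4 := by
  have : G.posDistMatrix = (B.map (Nat.cast : ℕ → ℝ)).submatrix c c := by
    ext v w
    simp [posDistMatrix, hc]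
  rw [this]
  exact (Matrix.rank_submatrix_le_card _ _).trans (by simp)

/-- This is the diagonal case `v = w` of `Matrix.apply_eq_of_rank_le`, multiplied by `m`. -/
theorem posDist_quadratic (hr : G.posDistMatrix.rank ≤ 4) {f : Fin 4 → V}
    {B : Matrix (Fin 4) (Fin 4) ℕ} {K : Matrix (Fin 4) (Fin 4) ℤ} {m : ℤ}
    (hB : ∀ i j, G.posDist (f i) (f j) = B i j)
    (hm : m ≠ 0) (hK : K * B.map (Nat.cast : ℕ → ℤ) = m • 1) (v : V) :
    ∑ i, ∑ j, (G.posDist v (f i) : ℤ) * K i j * G.posDist v (f j) = m := by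
  have h := Matrix.apply_eq_of_rank_le (by simpa using hr) f (exists_block_inverse hB hm hK) v v
  have hm' : (m : ℝ) ≠ 0 := by exact_mod_cast hm
  simp only [posDistMatrix, Matrix.of_apply, posDist_self, Nat.cast_one, Matrix.smul_apply,
    Matrix.map_apply, smul_eq_mul, G.posDist_comm _ v] at h
  have h' := congrArg (fun x => (m : ℝ) * x) h
  simp only [Finset.mul_sum, mul_one] at h'
  have h2 : ∑ i, ∑ j, (G.posDist v (f i) : ℝ) * K i j * G.posDist v (f j) = m := by
    rw [h']
    refine Finset.sum_congr rfl fun i _ => Finset.sum_congr rfl fun j _ => ?_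
    field_simp
  exact_mod_cast h2

theorem exists_posDist_eq_block (hr : G.posDistMatrix.rank ≤ 4) {f : Fin 4 → V}
    {B : Matrix (Fin 4) (Fin 4) ℕ} {K : Matrix (Fin 4) (Fin 4) ℤ} {m : ℤ}
    (hB : ∀ i j, G.posDist (f i) (f j) = B i j)
    (hm : m ≠ 0) (hK : K * B.map (Nat.cast : ℕ → ℤ) = m • 1)
    (h : ∀ v, ∃ i, ∀ j, G.posDist v (f j) = B i j) :
    ∃ c : V → Fin 4, ∀ v w, G.posDist v w = B (c v) (c w) := by
  choose c hc using h
  have := Matrix.eq_submatrix_of_rank_le G.posDistMatrix_isSymm (by simpa using hr) f rfl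
    (exists_block_inverse hB hm hK) c (fun v i => by
      simp only [posDistMatrix, Matrix.submatrix_apply, Matrix.of_apply, hc v i, hB])
  refine ⟨c, fun v w => ?_⟩
  have := congrFun (congrFun this v) w
  simpa [posDistMatrix, hB] using this

/-- The inverse of `pathBlock`. -/
def pathBlockInv : Matrix (Fin 4) (Fin 4) ℤ :=
  !![-1, 1, 2, -1; 1, -1, -3, 2; 2, -3, -1, 1; -1, 2, 1, -1]

theorem pathBlockInv_mul : pathBlockInv * pathBlock.map (Nat.cast : ℕ → ℤ) = (1 : ℤ) • 1 := by
  decide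

theorem posDist_ne_four (hG : G.Connected) (hr : G.posDistMatrix.rank ≤ 4) (a e : V) :
    G.dist a e ≠ 4 := by
  intro h
  obtain ⟨b, hab, hbe⟩ := hG.exists_dist_eq h
  obtain ⟨c, hbc, hce⟩ := hG.exists_dist_eq hbe
  obtain ⟨d, hcd, hde⟩ := hG.exists_dist_eq hce
  have t1 := hG.dist_triangle (u := a) (v := b) (w := c)
  have t2 := hG.dist_triangle (u := a) (v := c) (w := d)
  have t3 := hG.dist_triangle (u := b) (v := c) (w := d)
  have t4 := hG.dist_triangle (u := a) (v := c) (w := e)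
  have t5 := hG.dist_triangle (u := a) (v := d) (w := e)
  have t6 := hG.dist_triangle (u := b) (v := d) (w := e)
  have hac : G.dist a c = 2 := by omega
  have had : G.dist a d = 3 := by omega
  have hbd : G.dist b d = 2 := by omega
  have hB := posDist_block_of_six (G := G) (B := pathBlock) (a := a) (b := b) (c := c) (d := d)
    (by decide) (by decide) (by simp [posDist, *, pathBlock]) (by simp [posDist, *, pathBlock])
    (by simp [posDist, *, pathBlock]) (by simp [posDist, *, pathBlock])
    (by simp [posDist, *, pathBlock]) (by simp [posDist, *, pathBlock])
  -- The row of `e` is (4, 3, 2, 1), at which the form takes the value -2 instead of 1.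
  have hq := posDist_quadratic hr hB one_ne_zero pathBlockInv_mul e
  simp [Fin.sum_univ_four, pathBlockInv, posDist, G.dist_comm (u := e), *] at hq

theorem exists_pathBlock (hG : G.Connected) (hr : G.posDistMatrix.rank ≤ 4)
    (h3 : ∀ v w, G.posDist v w ≤ 3) {a b c d : V}
    (hab : G.posDist a b = 1) (hac : G.posDist a c = 2) (had : G.posDist a d = 3)
    (hbc : G.posDist b c = 1) (hbd : G.posDist b d = 2) (hcd : G.posDist c d = 1) :
    ∃ c : V → Fin 4, ∀ v w, G.posDist v w = pathBlock (c v) (c w) := by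
  have hB := posDist_block_of_six (G := G) (B := pathBlock) (by decide) (by decide)
    hab hac had hbc hbd hcd
  refine exists_posDist_eq_block hr hB one_ne_zero pathBlockInv_mul fun v => ?_
  have hq := posDist_quadratic hr hB one_ne_zero pathBlockInv_mul v
  have t1 := hG.posDist_le_add_one v hab
  have t2 := hG.posDist_le_add_one v ((G.posDist_comm b a).trans hab)
  have t3 := hG.posDist_le_add_one v hbc
  have t4 := hG.posDist_le_add_one v ((G.posDist_comm c b).trans hbc)
  have t5 := hG.posDist_le_add_one v hcd
  have t6 := hG.posDist_le_add_one v ((G.posDist_comm d c).trans hcd)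
  have la := G.one_le_posDist v a
  have lb := G.one_le_posDist v b
  have lc := G.one_le_posDist v c
  have ld := G.one_le_posDist v d
  have ua := h3 v a
  have ub := h3 v b
  have uc := h3 v c
  have ud := h3 v d
  clear hab hac had hbc hbd hcd hB
  simp [Fin.sum_univ_four, Fin.forall_fin_succ, Fin.exists_fin_succ, pathBlock, pathBlockInv] at hq ⊢
  generalize G.posDist v a = x at *
  generalize G.posDist v b = y at *
  generalize G.posDist v c = z at *
  generalize G.posDist v d = t at *
  -- Among rows with entries 1 to 3 and consecutive entries differing by at most 1, only the rows of
  -- `pathBlock` solve the quadratic equation.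
  interval_cases x <;> interval_cases y <;> interval_cases z <;> interval_cases t <;> omega

theorem exists_cycleBlock (hr : G.posDistMatrix.rank ≤ 4)
    (h2 : ∀ v w, G.posDist v w ≤ 2) {a b c d : V}
    (hab : G.posDist a b = 1) (hac : G.posDist a c = 2) (had : G.posDist a d = 1)
    (hbc : G.posDist b c = 1) (hbd : G.posDist b d = 2) (hcd : G.posDist c d = 1) :
    ∃ c : V → Fin 4, ∀ v w, G.posDist v w = cycleBlock (c v) (c w) := by
  have hB := posDist_block_of_six (G := G) (B := cycleBlock) (by decide) (by decide)
    hab hac had hbc hbd hcd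
  have hK : !![-1, -1, 4, -1; -1, -1, -1, 4; 4, -1, -1, -1; -1, 4, -1, -1]
    * cycleBlock.map (Nat.cast : ℕ → ℤ) = (5 : ℤ) • 1 := by decide
  refine exists_posDist_eq_block hr hB (by norm_num) hK fun v => ?_
  have hq := posDist_quadratic hr hB (by norm_num) hK v
  have la := G.one_le_posDist v a
  have lb := G.one_le_posDist v b
  have lc := G.one_le_posDist v c
  have ld := G.one_le_posDist v d
  have ua := h2 v a
  have ub := h2 v b
  have uc := h2 v c
  have ud := h2 v d
  clear hab hac had hbc hbd hcd hB
  simp [Fin.sum_univ_four, Fin.forall_fin_succ, Fin.exists_fin_succ, cycleBlock] at hq ⊢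
  generalize G.posDist v a = x at *
  generalize G.posDist v b = y at *
  generalize G.posDist v c = z at *
  generalize G.posDist v d = t at *
  interval_cases x <;> interval_cases y <;> interval_cases z <;> interval_cases t <;> omega

theorem exists_starBlock_of_star (hr : G.posDistMatrix.rank ≤ 4)
    (h2 : ∀ v w, G.posDist v w ≤ 2) {a b c d : V}
    (hab : G.posDist a b = 1) (hac : G.posDist a c = 1) (had : G.posDist a d = 1)
    (hbc : G.posDist b c = 2) (hbd : G.posDist b d = 2) (hcd : G.posDist c d = 2) :
    ∃ c : V → Fin 4, ∀ v w, G.posDist v w = starBlock (c v) (c w) := by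
  have hB := posDist_block_of_six (G := G) (B := starBlock) (by decide) (by decide)
    hab hac had hbc hbd hcd
  have hK : !![5, -1, -1, -1; -1, -1, 1, 1; -1, 1, -1, 1; -1, 1, 1, -1]
    * starBlock.map (Nat.cast : ℕ → ℤ) = (2 : ℤ) • 1 := by decide
  refine exists_posDist_eq_block hr hB (by norm_num) hK fun v => ?_
  have hq := posDist_quadratic hr hB (by norm_num) hK v
  have la := G.one_le_posDist v a
  have lb := G.one_le_posDist v b
  have lc := G.one_le_posDist v c
  have ld := G.one_le_posDist v d
  have ua := h2 v a
  have ub := h2 v b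
  have uc := h2 v c
  have ud := h2 v d
  clear hab hac had hbc hbd hcd hB
  simp [Fin.sum_univ_four, Fin.forall_fin_succ, Fin.exists_fin_succ, starBlock] at hq ⊢
  generalize G.posDist v a = x at *
  generalize G.posDist v b = y at *
  generalize G.posDist v c = z at *
  generalize G.posDist v d = t at *
  interval_cases x <;> interval_cases y <;> interval_cases z <;> interval_cases t <;> omega

/-- A common neighbour of the ends `a`, `d` makes the quadratic form even, while it should equal 3.
-/
theorem not_short_path (hG : G.Connected) (hr : G.posDistMatrix.rank ≤ 4)
    (h2 : ∀ v w, G.posDist v w ≤ 2) {a b c d : V}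
    (hab : G.posDist a b = 1) (hac : G.posDist a c = 2) (had : G.posDist a d = 2)
    (hbc : G.posDist b c = 1) (hbd : G.posDist b d = 2) (hcd : G.posDist c d = 1) : False := by
  have hB := posDist_block_of_six (G := G)
    (B := !![1, 1, 2, 2; 1, 1, 1, 2; 2, 1, 1, 1; 2, 2, 1, 1]) (by decide) (by decide)
    hab hac had hbc hbd hcd
  have hK : !![-1, 0, 3, -1; 0, 0, -3, 3; 3, -3, 0, 0; -1, 3, 0, -1]
    * (!![1, 1, 2, 2; 1, 1, 1, 2; 2, 1, 1, 1; 2, 2, 1, 1] : Matrix (Fin 4) (Fin 4) ℕ).map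
      (Nat.cast : ℕ → ℤ) = (3 : ℤ) • 1 := by decide
  obtain ⟨v, hav, hvd⟩ := hG.exists_posDist_eq_one had
  have hq := posDist_quadratic hr hB (by norm_num) hK v
  have lb := G.one_le_posDist v b
  have lc := G.one_le_posDist v c
  have ub := h2 v b
  have uc := h2 v c
  simp [Fin.sum_univ_four, hvd, G.posDist_comm v a, hav] at hq
  generalize G.posDist v b = y at *
  generalize G.posDist v c = z at *
  interval_cases y <;> interval_cases z <;> omega

/-- The same parity obstruction, for a common neighbour of `b` and `d`. -/
theorem not_path_add_point (hG : G.Connected) (hr : G.posDistMatrix.rank ≤ 4)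
    (h2 : ∀ v w, G.posDist v w ≤ 2) {a b c d : V}
    (hab : G.posDist a b = 1) (hac : G.posDist a c = 2) (had : G.posDist a d = 2)
    (hbc : G.posDist b c = 1) (hbd : G.posDist b d = 2) (hcd : G.posDist c d = 2) : False := by
  have hB := posDist_block_of_six (G := G)
    (B := !![1, 1, 2, 2; 1, 1, 1, 2; 2, 1, 1, 2; 2, 2, 2, 1]) (by decide) (by decide)
    hab hac had hbc hbd hcd
  have hK : !![0, -3, 3, 0; -3, 5, -3, 2; 3, -3, 0, 0; 0, 2, 0, -1]
    * (!![1, 1, 2, 2; 1, 1, 1, 2; 2, 1, 1, 2; 2, 2, 2, 1] : Matrix (Fin 4) (Fin 4) ℕ).map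
      (Nat.cast : ℕ → ℤ) = (3 : ℤ) • 1 := by decide
  obtain ⟨v, hbv, hvd⟩ := hG.exists_posDist_eq_one hbd
  have hq := posDist_quadratic hr hB (by norm_num) hK v
  have la := G.one_le_posDist v a
  have lc := G.one_le_posDist v c
  have ua := h2 v a
  have uc := h2 v c
  simp [Fin.sum_univ_four, hvd, G.posDist_comm v b, hbv] at hq
  generalize G.posDist v a = y at *
  generalize G.posDist v c = z at *
  interval_cases y <;> interval_cases z <;> omega

/-- A connected graph of diameter two whose matrix `D + 1` has rank at most four is a blow-up of
a cycle or of a star. The star may have an empty class. -/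
theorem exists_block_of_posDist_le_two (hG : G.Connected) (hr : G.posDistMatrix.rank ≤ 4)
    (h2 : ∀ v w, G.posDist v w ≤ 2) {a c : V} (hac : G.posDist a c = 2) :
    (∃ c : V → Fin 4, ∀ v w, G.posDist v w = cycleBlock (c v) (c w)) ∨
      ∃ c : V → Fin 4, ∀ v w, G.posDist v w = starBlock (c v) (c w) := by
  by_contra hno
  obtain ⟨hcyc, hst⟩ := not_or.1 hno
  obtain ⟨b, hab, hbc⟩ := hG.exists_posDist_eq_one hac
  have hS := G.posDist_comm
  have hor : ∀ v w, G.posDist v w = 1 ∨ G.posDist v w = 2 := fun v w => by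
    have := h2 v w
    have := G.one_le_posDist v w
    omega
  have hC : ∀ {a b c d : V}, G.posDist a b = 1 → G.posDist a c = 2 → G.posDist a d = 1 →
      G.posDist b c = 1 → G.posDist b d = 2 → G.posDist c d = 1 → False :=
    fun h₁ h₂ h₃ h₄ h₅ h₆ => hcyc (exists_cycleBlock hr h2 h₁ h₂ h₃ h₄ h₅ h₆)
  have hK : ∀ {a b c d : V}, G.posDist a b = 1 → G.posDist a c = 1 → G.posDist a d = 1 →
      G.posDist b c = 2 → G.posDist b d = 2 → G.posDist c d = 2 → False :=
    fun h₁ h₂ h₃ h₄ h₅ h₆ => hst (exists_starBlock_of_star hr h2 h₁ h₂ h₃ h₄ h₅ h₆)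
  have hP := @not_short_path V G _ hG hr h2
  have hQ := @not_path_add_point V G _ hG hr h2
  -- Of the eight possible rows on the induced path `a, b, c`, five create a forbidden four-vertex
  -- configuration; the rest are the path's own rows.
  have htype : ∀ v, (G.posDist v a = 1 ∧ G.posDist v b = 1 ∧ G.posDist v c = 2) ∨
      (G.posDist v a = 1 ∧ G.posDist v b = 1 ∧ G.posDist v c = 1) ∨
      (G.posDist v a = 2 ∧ G.posDist v b = 1 ∧ G.posDist v c = 1) := by
    intro v
    rcases hor v a with h | h <;> rcases hor v b with h' | h' <;> rcases hor v c with h'' | h''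
    · simp [h, h', h'']
    · simp [h, h', h'']
    · exact (hC hab hac ((hS _ _).trans h) hbc ((hS _ _).trans h') ((hS _ _).trans h'')).elim
    · exact (hP h h' h'' hab hac hbc).elim
    · simp [h, h', h'']
    · exact (hK ((hS _ _).trans hab) hbc ((hS _ _).trans h') hac ((hS _ _).trans h)
        ((hS _ _).trans h'')).elim
    · exact (hP hab hac ((hS _ _).trans h) hbc ((hS _ _).trans h') ((hS _ _).trans h'')).elim
    · exact (hQ hab hac ((hS _ _).trans h) hbc ((hS _ _).trans h') ((hS _ _).trans h'')).elim
  have hleaf : ∀ {c v w}, G.posDist b c = 1 →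
      G.posDist v b = 1 → G.posDist v c = 2 → G.posDist w b = 1 → G.posDist w c = 2 →
      G.posDist v w = 1 := by
    intro c v w hbc hvb hvc hwb hwc
    refine (hor v w).resolve_right fun h => ?_
    exact hK ((hS _ _).trans hvb) ((hS _ _).trans hwb) hbc h hvc hwc
  have hcentre : ∀ {v w}, G.posDist v a = 1 → G.posDist v c = 1 → G.posDist w a = 1 →
      G.posDist w c = 1 → G.posDist v w = 1 := by
    intro v w hva hvc hwa hwc
    refine (hor v w).resolve_right fun h => ?_
    exact hC ((hS _ _).trans hva) hac ((hS _ _).trans hwa) hvc h ((hS _ _).trans hwc)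
  have hopp : ∀ {v w}, G.posDist v a = 1 → G.posDist v c = 2 → G.posDist w a = 2 →
      G.posDist w c = 1 → G.posDist v w = 2 := by
    intro v w hva hvc hwa hwc
    refine (hor v w).resolve_left fun h => ?_
    exact hP ((hS _ _).trans hva) ((hS _ _).trans hwa) hac h hvc hwc
  have hmid : ∀ {a c v w}, G.posDist a c = 2 → G.posDist v a = 1 → G.posDist v c = 2 →
      G.posDist w a = 1 → G.posDist w c = 1 → G.posDist v w = 1 := by
    intro a c v w hac hva hvc hwa hwc
    refine (hor v w).resolve_right fun h => ?_
    exact hP hva h hvc ((hS _ _).trans hwa) hac hwc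
  -- A blow-up of the path `a, b, c` is one of the star with leaf class 3 empty.
  refine hst ⟨fun v => if G.posDist v c = 2 then 1 else if G.posDist v a = 2 then 2 else 0,
    fun v w => ?_⟩
  rcases htype v with ⟨v1, v2, v3⟩ | ⟨v1, v2, v3⟩ | ⟨v1, v2, v3⟩ <;>
    rcases htype w with ⟨w1, w2, w3⟩ | ⟨w1, w2, w3⟩ | ⟨w1, w2, w3⟩ <;>
    simp only [v1, v3, w1, w3, starBlock] <;> simp
  · exact hleaf hbc v2 v3 w2 w3
  · exact hmid hac v1 v3 w1 w3
  · exact hopp v1 v3 w1 w3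
  · exact (hS _ _).trans (hmid hac w1 w3 v1 v3)
  · exact hcentre v1 v3 w1 w3
  · exact (hS _ _).trans (hmid ((hS _ _).trans hac) w3 w1 v3 v1)
  · exact (hS _ _).trans (hopp w1 w3 v1 v3)
  · exact hmid ((hS _ _).trans hac) v3 v1 w3 w1
  · exact hleaf ((hS _ _).trans hab) v2 v1 w2 w1

theorem exists_block_of_rank_le_four (hG : G.Connected) (hr : G.posDistMatrix.rank ≤ 4) :
    ∃ B ∈ ({pathBlock, cycleBlock, starBlock} : Set (Matrix (Fin 4) (Fin 4) ℕ)),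
      ∃ c : V → Fin 4, ∀ v w, G.posDist v w = B (c v) (c w) := by
  have h3 : ∀ v w, G.dist v w ≤ 3 := fun v w => by
    by_contra! h
    obtain ⟨u, hu⟩ := hG.exists_dist_eq_of_le (k := 4) h
    exact posDist_ne_four hG hr u w hu
  by_cases h : ∃ a d, G.dist a d = 3
  · obtain ⟨a, d, had⟩ := h
    obtain ⟨b, hab, hbd⟩ := hG.exists_dist_eq had
    obtain ⟨c, hbc, hcd⟩ := hG.exists_dist_eq hbd
    have t1 := hG.dist_triangle (u := a) (v := b) (w := c)
    have t2 := hG.dist_triangle (u := a) (v := c) (w := d)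
    have hac : G.dist a c = 2 := by omega
    exact ⟨_, by simp, exists_pathBlock hG hr (fun v w => max_le (by norm_num) (h3 v w))
      (a := a) (b := b) (c := c) (d := d) (by simp [posDist, *]) (by simp [posDist, *])
      (by simp [posDist, *]) (by simp [posDist, *]) (by simp [posDist, *]) (by simp [posDist, *])⟩
  push Not at h
  have h2 : ∀ v w, G.posDist v w ≤ 2 := fun v w => by
    have := h v w
    have := h3 v w
    unfold posDist
    omega
  by_cases h' : ∃ a c, G.posDist a c = 2
  · obtain ⟨a, c, hac⟩ := h'
    rcases exists_block_of_posDist_le_two hG hr h2 hac with h | h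
    · exact ⟨_, by simp, h⟩
    · exact ⟨_, by simp, h⟩
  push Not at h'
  -- All entries are 1: the graph is complete, a blow-up with a single class.
  refine ⟨starBlock, by simp, fun _ => 0, fun v w => ?_⟩
  have := h' v w
  have := h2 v w
  have := G.one_le_posDist v w
  simp [starBlock]
  omega

end Rank
end SimpleGraph

/-! ### Class sizes from the spectrum -/

namespace SimpleGraph

/-- The coefficient of `y ^ k` sums the principal `k`-minors of the block, each times the product of
its weights. -/
theorem det_one_add_smul_pathBlock (y : ℝ) (w : Fin 4 → ℝ) :
    (1 + y • (pathBlock.map (Nat.cast : ℕ → ℝ) * Matrix.diagonal w)).det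
      = 1 + (w 0 + w 1 + w 2 + w 3) * y - (3 * (w 0 * w 2 + w 1 * w 3) + 8 * (w 0 * w 3)) * y ^ 2
        - (w 0 * w 1 * w 2 + w 1 * w 2 * w 3 + w 0 * w 1 * w 3 + w 0 * w 2 * w 3) * y ^ 3
        + w 0 * w 1 * w 2 * w 3 * y ^ 4 := by
  simp [Matrix.det_succ_row_zero, Fin.sum_univ_succ, pathBlock, Fin.succAbove, Matrix.one_apply]
  ring

theorem det_one_add_smul_cycleBlock (y : ℝ) (w : Fin 4 → ℝ) :
    (1 + y • (cycleBlock.map (Nat.cast : ℕ → ℝ) * Matrix.diagonal w)).det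
      = 1 + (w 0 + w 1 + w 2 + w 3) * y - 3 * (w 0 * w 2 + w 1 * w 3) * y ^ 2
        - (w 0 * w 1 * w 2 + w 1 * w 2 * w 3 + w 0 * w 1 * w 3 + w 0 * w 2 * w 3) * y ^ 3
        + 5 * (w 0 * w 1 * w 2 * w 3) * y ^ 4 := by
  simp [Matrix.det_succ_row_zero, Fin.sum_univ_succ, cycleBlock, Fin.succAbove, Matrix.one_apply]
  ring

theorem det_one_add_smul_starBlock (y : ℝ) (w : Fin 4 → ℝ) :
    (1 + y • (starBlock.map (Nat.cast : ℕ → ℝ) * Matrix.diagonal w)).det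
      = 1 + (w 0 + w 1 + w 2 + w 3) * y - 3 * (w 1 * w 2 + w 1 * w 3 + w 2 * w 3) * y ^ 2
        - (w 0 * w 1 * w 2 + w 0 * w 1 * w 3 + w 0 * w 2 * w 3 - 5 * (w 1 * w 2 * w 3)) * y ^ 3
        + 2 * (w 0 * w 1 * w 2 * w 3) * y ^ 4 := by
  simp [Matrix.det_succ_row_zero, Fin.sum_univ_succ, starBlock, Fin.succAbove, Matrix.one_apply]
  ring

theorem path_weights {x a b y p q : ℕ} (hp : 1 ≤ p) (hq : 1 ≤ q)
    (h1 : x + a + b + y = p + 1 + 1 + q)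
    (h2 : 3 * (x * b + a * y) + 8 * (x * y) = 3 * (p + q) + 8 * (p * q))
    (h4 : x * a * b * y = p * q) : a = 1 ∧ b = 1 ∧ (x = p ∧ y = q ∨ x = q ∧ y = p) := by
  have hpos : 0 < x * a * b * y := h4 ▸ Nat.mul_pos hp hq
  obtain ⟨⟨⟨hx, ha⟩, hb⟩, hy⟩ : ((0 < x ∧ 0 < a) ∧ 0 < b) ∧ 0 < y := by
    simpa [pos_iff_ne_zero] using hpos
  obtain ⟨x, rfl⟩ := Nat.exists_eq_add_of_lt hx
  obtain ⟨a, rfl⟩ := Nat.exists_eq_add_of_lt ha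
  obtain ⟨b, rfl⟩ := Nat.exists_eq_add_of_lt hb
  obtain ⟨y, rfl⟩ := Nat.exists_eq_add_of_lt hy
  simp only [zero_add] at *
  rw [← h4] at h2
  -- With each weight lowered by 1, the equations give `3(xb + ay) = 8(x+1)(y+1)(ab + a + b)`, and
  -- the right side is at least `8(a + b + xb + ay)`.
  have key : 8 * a + 8 * b ≤ 0 := by
    have hS : p + q = x + a + b + y + 2 := by omega
    rw [hS] at h2
    nlinarith [Nat.zero_le (x * a * b * y), Nat.zero_le (x * a * b), Nat.zero_le (x * a * y),
      Nat.zero_le (x * b * y), Nat.zero_le (a * b * y), Nat.zero_le (x * a), Nat.zero_le (x * b),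
      Nat.zero_le (a * b), Nat.zero_le (a * y), Nat.zero_le (b * y)]
  obtain rfl : a = 0 := by omega
  obtain rfl : b = 0 := by omega
  refine ⟨rfl, rfl, ?_⟩
  simp only [zero_add, mul_one] at h4 h1
  obtain ⟨p, rfl⟩ := Nat.exists_eq_add_of_le' hp
  have : ((x : ℤ) - p) * (y - p) = 0 := by
    have e1 : (q : ℤ) = x + y + 1 - p := by omega
    have e2 : ((x : ℤ) + 1) * (y + 1) = (p + 1) * q := by exact_mod_cast h4
    rw [e1] at e2
    linarith
  rcases mul_eq_zero.1 this with h | h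
  · left; omega
  · right; omega

/-- With `u = xb` and `v = ay` positive, `3(u + v) ≤ 6uv`, whereas `8pq = 40uv`. -/
theorem cycle_weights {x a b y p q : ℕ} (hp : 1 ≤ p) (hq : 1 ≤ q)
    (h2 : 3 * (x * b + a * y) = 3 * (p + q) + 8 * (p * q))
    (h4 : 5 * (x * a * b * y) = p * q) : False := by
  have hu : 5 * ((x * b) * (a * y)) = p * q := by rw [← h4]; ring
  generalize x * b = u at *
  generalize a * y = v at *
  have hpos : 0 < p * q := Nat.mul_pos hp hq
  have hu0 : 1 ≤ u := Nat.one_le_iff_ne_zero.2 (by rintro rfl; simp at hu; omega)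
  have hv0 : 1 ≤ v := Nat.one_le_iff_ne_zero.2 (by rintro rfl; simp at hu; omega)
  have := Nat.mul_le_mul_left u hv0
  have := Nat.mul_le_mul_right v hu0
  omega

/-- Each pairwise product is at most `cxyz`, so the left side of `h2` is at most `9cxyz`, below `8pq
= 16cxyz`. -/
theorem star_weights {c x y z p q : ℕ} (hp : 1 ≤ p) (hq : 1 ≤ q)
    (h2 : 3 * (x * y + x * z + y * z) = 3 * (p + q) + 8 * (p * q))
    (h4 : 2 * (c * x * y * z) = p * q) : False := by
  have hpos : 0 < c * x * y * z := by
    have := Nat.mul_pos hp hq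
    omega
  obtain ⟨⟨⟨hc, hx⟩, hy⟩, hz⟩ : ((0 < c ∧ 0 < x) ∧ 0 < y) ∧ 0 < z := by
    simpa [pos_iff_ne_zero] using hpos
  have h5 : x * y * z ≤ c * x * y * z := by
    calc x * y * z = 1 * (x * y * z) := (one_mul _).symm
      _ ≤ c * (x * y * z) := Nat.mul_le_mul_right _ hc
      _ = _ := by ring
  have h6 : x * y * 1 ≤ x * y * z := Nat.mul_le_mul_left _ hz
  have h7 : x * 1 * z ≤ x * y * z := Nat.mul_le_mul_right _ (Nat.mul_le_mul_left _ hy)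
  have h8 : 1 * y * z ≤ x * y * z := Nat.mul_le_mul_right _ (Nat.mul_le_mul_right _ hx)
  simp only [mul_one, one_mul] at h6 h7 h8
  omega

section Spectrum

variable {V W : Type*} [Fintype V] [DecidableEq V] [Fintype W] [DecidableEq W]
  {G : SimpleGraph V} {H : SimpleGraph W}

theorem Connected.rank_posDistMatrix_eq (hG : G.Connected) (hH : H.Connected)
    (h : H.distanceSpectrum = G.distanceSpectrum) :
    H.posDistMatrix.rank = G.posDistMatrix.rank := by
  have hr := fun x y => G.distanceMatrix_isHermitian.rank_smul_one_add_smul x y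
  have hr' := fun x y => H.distanceMatrix_isHermitian.rank_smul_one_add_smul x y
  unfold distanceSpectrum at h
  rw [hG.posDistMatrix_eq, hH.posDistMatrix_eq]
  have h1 := hr 1 1
  have h2 := hr' 1 1
  rw [one_smul, one_smul] at h1 h2
  rw [h1, h2, h]

theorem Connected.det_one_add_smul_posDistMatrix_eq (hG : G.Connected) (hH : H.Connected)
    (h : H.distanceSpectrum = G.distanceSpectrum) (y : ℝ) :
    (1 + y • H.posDistMatrix).det = (1 + y • G.posDistMatrix).det := by
  have hG' : 1 + y • G.posDistMatrix = (1 + y) • 1 + y • G.distanceMatrix := by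
    rw [hG.posDistMatrix_eq]; module
  have hH' : 1 + y • H.posDistMatrix = (1 + y) • 1 + y • H.distanceMatrix := by
    rw [hH.posDistMatrix_eq]; module
  rw [hG', hH', G.distanceMatrix_isHermitian.det_smul_one_add_smul,
    H.distanceMatrix_isHermitian.det_smul_one_add_smul]
  have := congrArg (fun m => (m.map fun z => 1 + y + y * z).prod) h
  simpa [distanceSpectrum] using this

theorem det_one_add_smul_posDistMatrix {B : Matrix (Fin 4) (Fin 4) ℕ} {c : V → Fin 4}
    (hc : ∀ v w, G.posDist v w = B (c v) (c w)) (y : ℝ) :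
    (1 + y • G.posDistMatrix).det = (1 + y • (B.map (Nat.cast : ℕ → ℝ)
      * Matrix.diagonal fun i => (Fintype.card {v // c v = i} : ℝ))).det := by
  have : G.posDistMatrix = (B.map (Nat.cast : ℕ → ℝ)).submatrix c c := by
    ext v w
    simp [posDistMatrix, hc]
  rw [this, Matrix.det_one_add_smul_submatrix]

theorem pathBlock_rev (i j : Fin 4) : pathBlock i.rev j.rev = pathBlock i j := by
  fin_cases i <;> fin_cases j <;> rfl

/-- A graph that has the distance spectrum of a blow-up of a path with class sizes `p, 1, 1, q`
is such a blow-up. -/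
theorem exists_pathBlock_of_distanceSpectrum_eq (hG : G.Connected) (hH : H.Connected)
    (h : H.distanceSpectrum = G.distanceSpectrum) {p q : ℕ} (hp : 1 ≤ p) (hq : 1 ≤ q)
    {c : V → Fin 4} (hc : ∀ v w, G.posDist v w = pathBlock (c v) (c w))
    (hcard : ∀ i, Fintype.card {v // c v = i} = ![p, 1, 1, q] i) :
    ∃ d : W → Fin 4, (∀ v w, H.posDist v w = pathBlock (d v) (d w)) ∧
      ∀ i, Fintype.card {v // d v = i} = ![p, 1, 1, q] i := by
  have hr : H.posDistMatrix.rank ≤ 4 :=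
    (hG.rank_posDistMatrix_eq hH h).trans_le (rank_posDistMatrix_le hc)
  have hdet := hG.det_one_add_smul_posDistMatrix_eq hH h
  obtain ⟨B, hB, d, hd⟩ := exists_block_of_rank_le_four hH hr
  simp only [det_one_add_smul_posDistMatrix hc, det_one_add_smul_posDistMatrix hd, hcard,
    det_one_add_smul_pathBlock] at hdet
  -- Both sides are quartics in `y` with constant term 1, so four nonzero values determine the
  -- coefficients.
  have e1 := hdet 1
  have e2 := hdet (-1)
  have e3 := hdet 2
  have e4 := hdet (-2)
  clear hdet
  generalize hw : (fun i => Fintype.card {v // d v = i}) = w at *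
  have hw' : ∀ i, Fintype.card {v // d v = i} = w i := fun i => congrFun hw i
  simp only [hw'] at e1 e2 e3 e4
  rcases hB with rfl | rfl | rfl
  · rw [det_one_add_smul_pathBlock] at e1 e2 e3 e4
    simp at e1 e2 e3 e4
    have a1 : (w 0 + w 1 + w 2 + w 3 : ℝ) = p + 1 + 1 + q := by linarith
    have a2 : (3 * (w 0 * w 2 + w 1 * w 3) + 8 * (w 0 * w 3) : ℝ) = 3 * (p + q) + 8 * (p * q) := by
      linarith
    have a4 : (w 0 * w 1 * w 2 * w 3 : ℝ) = p * q := by linarith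
    obtain ⟨h1, h2, h3⟩ := path_weights hp hq (by exact_mod_cast a1) (by exact_mod_cast a2)
      (by exact_mod_cast a4)
    rcases h3 with ⟨h0, h3⟩ | ⟨h0, h3⟩
    · refine ⟨d, hd, fun i => ?_⟩
      rw [hw']
      fin_cases i <;> simp [h0, h1, h2, h3]
    · refine ⟨fun v => (d v).rev, fun v w => by rw [pathBlock_rev, hd], fun i => ?_⟩
      have : Fintype.card {v // (d v).rev = i} = w i.rev := by
        rw [← hw']
        exact Fintype.card_congr (Equiv.subtypeEquivRight fun v => Fin.rev_eq_iff)
      rw [this]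
      fin_cases i <;> simp [Fin.rev, h0, h1, h2, h3]
  · rw [det_one_add_smul_cycleBlock] at e1 e2 e3 e4
    simp at e1 e2 e3 e4
    have a2 : (3 * (w 0 * w 2 + w 1 * w 3) : ℝ) = 3 * (p + q) + 8 * (p * q) := by linarith
    have a4 : (5 * (w 0 * w 1 * w 2 * w 3) : ℝ) = p * q := by linarith
    exact (cycle_weights hp hq (by exact_mod_cast a2) (by exact_mod_cast a4)).elim
  · rw [det_one_add_smul_starBlock] at e1 e2 e3 e4
    simp at e1 e2 e3 e4
    have a2 : (3 * (w 1 * w 2 + w 1 * w 3 + w 2 * w 3) : ℝ) = 3 * (p + q) + 8 * (p * q) := by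
      linarith
    have a4 : (2 * (w 0 * w 1 * w 2 * w 3) : ℝ) = p * q := by linarith
    exact (star_weights hp hq (by exact_mod_cast a2) (by exact_mod_cast a4)).elim

end Spectrum

/-- Any bijection preserving classes works, since adjacency means distinctness and entry 1. -/
theorem nonempty_iso_of_posDist_eq_block {V W ι : Type*} [Fintype V] [Fintype W] [DecidableEq ι]
    {G : SimpleGraph V} {H : SimpleGraph W} (hG : G.Connected) (hH : H.Connected)
    {B : Matrix ι ι ℕ} {c : V → ι} {d : W → ι}
    (hc : ∀ v w, G.posDist v w = B (c v) (c w)) (hd : ∀ v w, H.posDist v w = B (d v) (d w))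
    (hcard : ∀ i, Fintype.card {v // d v = i} = Fintype.card {v // c v = i}) :
    Nonempty (H ≃g G) := by
  let e : W ≃ V := (Equiv.sigmaFiberEquiv d).symm.trans
    ((Equiv.sigmaCongrRight fun i => Fintype.equivOfCardEq (hcard i)).trans
      (Equiv.sigmaFiberEquiv c))
  have he : ∀ v, c (e v) = d v := fun v =>
    (Fintype.equivOfCardEq (hcard (d v)) ⟨v, rfl⟩).2
  refine ⟨e, fun {v w} => ?_⟩
  rw [hG.adj_iff_posDist, hH.adj_iff_posDist, hc, hd, he, he, e.injective.ne_iff]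

end SimpleGraph

/-! ### The distance matrix of the target graph -/

namespace SimpleGraph

section Target

variable {s t : ℕ}

/-- The position of a vertex of `joinedCompleteGraphs s t a b` along the path that remains when
`K_s - a` and `K_t - b` are each contracted to a point. -/
def joinedClass (a : Fin s) (b : Fin t) : Fin s ⊕ Fin t → Fin 4 :=
  Sum.elim (fun i => if i = a then 1 else 0) (fun j => if j = b then 2 else 3)

variable (a : Fin s) (b : Fin t)

theorem joinedCompleteGraphs_adj_inl {i j : Fin s} (h : i ≠ j) :
    (joinedCompleteGraphs s t a b).Adj (.inl i) (.inl j) := by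
  simp [joinedCompleteGraphs, completeGraph, h]

theorem joinedCompleteGraphs_adj_inr {i j : Fin t} (h : i ≠ j) :
    (joinedCompleteGraphs s t a b).Adj (.inr i) (.inr j) := by
  simp [joinedCompleteGraphs, completeGraph, h]

theorem joinedCompleteGraphs_adj_inl_inr {i : Fin s} {j : Fin t} :
    (joinedCompleteGraphs s t a b).Adj (.inl i) (.inr j) ↔ i = a ∧ j = b := by
  simp [joinedCompleteGraphs, edge_adj]

theorem joinedCompleteGraphs_connected : (joinedCompleteGraphs s t a b).Connected := by
  have hr : ∀ v, (joinedCompleteGraphs s t a b).Reachable v (.inl a) := by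
    have hb : (joinedCompleteGraphs s t a b).Reachable (.inr b) (.inl a) :=
      ((joinedCompleteGraphs_adj_inl_inr a b).2 ⟨rfl, rfl⟩).symm.reachable
    rintro (i | j)
    · by_cases h : i = a
      · rw [h]
      · exact (joinedCompleteGraphs_adj_inl a b h).reachable
    · by_cases h : j = b
      · rwa [h]
      · exact (joinedCompleteGraphs_adj_inr a b h).reachable.trans hb
  have : Nonempty (Fin s ⊕ Fin t) := ⟨.inl a⟩
  exact ⟨fun v w => (hr v).trans (hr w).symm⟩

theorem joinedClass_adj_le {v w : Fin s ⊕ Fin t} (h : (joinedCompleteGraphs s t a b).Adj v w) :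
    (joinedClass a b w : ℕ) ≤ joinedClass a b v + 1 := by
  rcases v with i | i <;> rcases w with j | j
  · simp only [joinedClass, Sum.elim_inl]
    split_ifs <;> simp
  · obtain ⟨rfl, rfl⟩ := (joinedCompleteGraphs_adj_inl_inr a b).1 h
    simp [joinedClass]
  · obtain ⟨rfl, rfl⟩ := (joinedCompleteGraphs_adj_inl_inr a b).1 h.symm
    simp [joinedClass]
  · simp only [joinedClass, Sum.elim_inr]
    split_ifs <;> simp

/-- The class index changes by at most 1 along an edge, which bounds distances from below. -/
theorem joinedClass_le_add_dist (v w : Fin s ⊕ Fin t) :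
    (joinedClass a b w : ℕ) ≤ joinedClass a b v + (joinedCompleteGraphs s t a b).dist v w := by
  obtain ⟨p, hp⟩ := (joinedCompleteGraphs_connected a b).exists_walk_length_eq_dist v w
  rw [← hp]
  clear hp
  induction p with
  | nil => simp
  | cons h p ih =>
    have := joinedClass_adj_le a b h
    rw [Walk.length_cons]
    omega

theorem joinedCompleteGraphs_posDist (v w : Fin s ⊕ Fin t) :
    (joinedCompleteGraphs s t a b).posDist v w
      = pathBlock (joinedClass a b v) (joinedClass a b w) := by
  -- Subtraction is truncated, so the inner maximum is `|i - j|`.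
  have hB : ∀ i j : Fin 4, pathBlock i j = max 1 (max (i - j : ℕ) (j - i : ℕ)) := by
    intro i j
    fin_cases i <;> fin_cases j <;> rfl
  have h1 := joinedClass_le_add_dist a b v w
  have h2 := joinedClass_le_add_dist a b w v
  rw [dist_comm] at h2
  rw [hB, posDist]
  suffices h : (joinedCompleteGraphs s t a b).dist v w ≤ max 1
      (max (joinedClass a b v - joinedClass a b w : ℕ) (joinedClass a b w - joinedClass a b v : ℕ)) by
    omega
  clear h1 h2
  have hl : ∀ i j : Fin s, (joinedCompleteGraphs s t a b).dist (.inl i) (.inl j)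
      ≤ if i = j then 0 else 1 := fun i j => by
    split_ifs with h
    · simp [h]
    · exact (dist_eq_one_iff_adj.2 (joinedCompleteGraphs_adj_inl a b h)).le
  have hr : ∀ i j : Fin t, (joinedCompleteGraphs s t a b).dist (.inr i) (.inr j)
      ≤ if i = j then 0 else 1 := fun i j => by
    split_ifs with h
    · simp [h]
    · exact (dist_eq_one_iff_adj.2 (joinedCompleteGraphs_adj_inr a b h)).le
  -- The route across the bridge gives the upper bound.
  have hlr : ∀ (i : Fin s) (j : Fin t), (joinedCompleteGraphs s t a b).dist (.inl i) (.inr j)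
      ≤ (if i = a then 0 else 1) + 1 + if b = j then 0 else 1 := fun i j => by
    have h := (joinedCompleteGraphs_connected a b)
    have h1 := h.dist_triangle (u := .inl i) (v := .inl a) (w := .inr j)
    have h2 := h.dist_triangle (u := .inl a) (v := .inr b) (w := .inr j)
    have h3 := dist_eq_one_iff_adj.2 ((joinedCompleteGraphs_adj_inl_inr a b).2 ⟨rfl, rfl⟩)
    have h4 := hl i a
    have h5 := hr b j
    omega
  rcases v with i | i <;> rcases w with j | j
  · refine (hl i j).trans ?_
    split_ifs <;> simp
  · refine (hlr i j).trans ?_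
    simp only [joinedClass, Sum.elim_inl, Sum.elim_inr, eq_comm (a := b)]
    split_ifs <;> simp
  · rw [dist_comm]
    refine (hlr j i).trans ?_
    simp only [joinedClass, Sum.elim_inl, Sum.elim_inr, eq_comm (a := b)]
    split_ifs <;> simp
  · refine (hr i j).trans ?_
    split_ifs <;> simp

theorem card_joinedClass (k : Fin 4) :
    Fintype.card {v // joinedClass a b v = k} = ![s - 1, 1, 1, t - 1] k := by
  rw [Fintype.card_subtype, Finset.card_filter, Fintype.sum_sum_type]
  fin_cases k <;> simp [joinedClass, ite_eq_iff] <;>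
    simp [Finset.sum_ite, Finset.filter_ne']

end Target

end SimpleGraph

theorem theorem3p4 (s t : ℕ) (hs : 2 ≤ s) (ht : 2 ≤ t) (a : Fin s) (b : Fin t) :
    SimpleGraph.IsDeterminedByDistanceSpectrum.{0, v}
      (SimpleGraph.joinedCompleteGraphs s t a b) := by
  have hG := SimpleGraph.joinedCompleteGraphs_connected a b
  refine ⟨hG, fun W _ _ H hH h => ?_⟩
  have hc := SimpleGraph.joinedCompleteGraphs_posDist a b
  have hcard := SimpleGraph.card_joinedClass a b
  obtain ⟨d, hd, hd'⟩ := SimpleGraph.exists_pathBlock_of_distanceSpectrum_eq hG hH h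
    (by omega) (by omega) hc hcard
  exact SimpleGraph.nonempty_iso_of_posDist_eq_block hG hH hc hd fun i => by rw [hd', hcard]
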